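/- Let $(R,\mathfrak m)$ be a complete noetherian normal local domain of dimension $d\ge 2$ and let $\mathfrak a\subset R$ be an ideal of height $d-1$. Let $X=\operatorname{Spec}(R)\setminus\{\mathfrak m\}$ be the punctured spectrum, let $Y=V(\mathfrak a)\setminus\{\mathfrak m\}$, and let $(\widehat X,\mathcal O_{\widehat X})$ be the formal completion of $X$ along $Y$, i.e. the space $Y$ with the sheaf of rings $\varprojlim_n \mathcal O_X/\mathcal I^n$, where $\mathcal I$ is the ideal sheaf on $X$ associated with $\mathfrak a$. One says that $Y$ is $G_2$ in $X$ if the canonical map $H^0(X,\mathcal O_X)\to H^0(\widehat X,\mathcal O_{\widehat X})$ is an isomorphism. Then $Y$ is not $G_2$ in $X$. Moreover, the canonical map $R\to H^0(X,\mathcal O_X)$ is an isomorphism, while $H^0(\widehat X,\mathcal O_{\widehat X})$ is not a finitely generated $R$-module. -/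

import Mathlib

open CategoryTheory AlgebraicGeometry TopologicalSpace Opposite

universe u

namespace FormalCompletion

section general

variable {X : Scheme.{u}} (I : X.IdealSheafData)

/-- The `n`-th infinitesimal neighbourhood of `V(I)` in `X`: the closed subscheme of `X`
with structure sheaf `𝒪_X / I ^ (n + 1)`. -/
noncomputable abbrev nbhd (n : ℕ) : Scheme.{u} := (I ^ (n + 1)).subscheme

/-- The closed immersion of the `n`-th infinitesimal neighbourhood into `X`. -/
noncomputable abbrev nbhdι (n : ℕ) : nbhd I n ⟶ X := (I ^ (n + 1)).subschemeι

lemma pow_succ_le (n : ℕ) : I ^ (n + 1 + 1) ≤ I ^ (n + 1) := by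
  intro U
  exact Ideal.pow_le_pow_right (Nat.le_succ _)

/-- The closed immersion of the `n`-th infinitesimal neighbourhood into the next one. -/
noncomputable def transition (n : ℕ) : nbhd I n ⟶ nbhd I (n + 1) :=
  Scheme.IdealSheafData.inclusion (pow_succ_le I n)

lemma transition_ι (n : ℕ) : transition I n ≫ nbhdι I (n + 1) = nbhdι I n :=
  Scheme.IdealSheafData.inclusion_subschemeι _

/-- The closed subset `Y = V(I)` of `X`, the underlying space of the formal completion. -/
abbrev space : TopCat.{u} := TopCat.of (I.support : Set X)

lemma nbhdι_mem (n : ℕ) (y : nbhd I n) : nbhdι I n y ∈ (I.support : Set X) := by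
  have h : nbhdι I n y ∈ Set.range (nbhdι I n) := ⟨y, rfl⟩
  rw [Scheme.IdealSheafData.range_subschemeι] at h
  exact h

/-- The identification of the underlying space of the `n`-th infinitesimal neighbourhood
with `Y` (as a continuous map). -/
noncomputable def toSpace (n : ℕ) : (nbhd I n).carrier ⟶ space I :=
  TopCat.ofHom ⟨fun y ↦ ⟨nbhdι I n y, nbhdι_mem I n y⟩,
    (nbhdι I n).continuous.subtype_mk _⟩

/-- The open subset `V` of `Y` regarded as an open subset of the `n`-th infinitesimal
neighbourhood. -/
noncomputable abbrev pull (n : ℕ) (V : Opens (space I)) : (nbhd I n).Opens :=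
  (Opens.map (toSpace I n)).obj V

lemma pull_le (n : ℕ) (V : Opens (space I)) :
    pull I n V ≤ transition I n ⁻¹ᵁ pull I (n + 1) V := by
  intro y hy
  have h : nbhdι I (n + 1) (transition I n y) = nbhdι I n y := by
    rw [← transition_ι I n]; rfl
  change (⟨nbhdι I (n + 1) (transition I n y), _⟩ : space I) ∈ V
  have hy' : (⟨nbhdι I n y, nbhdι_mem I n y⟩ : space I) ∈ V := hy
  convert hy' using 2

/-- The transition map `𝒪_X / I ^ (n + 2) → 𝒪_X / I ^ (n + 1)` on sections over `V`. -/
noncomputable def transitionMap (n : ℕ) (V : Opens (space I)) :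
    Γ(nbhd I (n + 1), pull I (n + 1) V) ⟶ Γ(nbhd I n, pull I n V) :=
  (transition I n).appLE (pull I (n + 1) V) (pull I n V) (pull_le I n V)

/-- The sections over `V` of `lim_n 𝒪_X / I ^ (n + 1)`: compatible families of sections. -/
noncomputable def sections (V : Opens (space I)) :
    Subring (∀ n : ℕ, Γ(nbhd I n, pull I n V)) where
  carrier := {s | ∀ n, (transitionMap I n V).hom (s (n + 1)) = s n}
  mul_mem' ha hb n := by simp [ha n, hb n]
  one_mem' n := by simp
  add_mem' ha hb n := by simp [ha n, hb n]
  zero_mem' n := by simp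
  neg_mem' ha n := by simp [ha n]

/-- Restriction of sections of the `n`-th infinitesimal neighbourhood. -/
noncomputable abbrev res (n : ℕ) {V W : Opens (space I)} (h : V ≤ W) :
    Γ(nbhd I n, pull I n W) ⟶ Γ(nbhd I n, pull I n V) :=
  (nbhd I n).presheaf.map ((Opens.map (toSpace I n)).map (homOfLE h)).op

lemma res_transition (n : ℕ) {V W : Opens (space I)} (h : V ≤ W) :
    res I (n + 1) h ≫ transitionMap I n V = transitionMap I n W ≫ res I n h := by
  simp only [transitionMap, Scheme.Hom.appLE_map, Scheme.Hom.map_appLE]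

lemma res_transition_apply (n : ℕ) {V W : Opens (space I)} (h : V ≤ W)
    (s : Γ(nbhd I (n + 1), pull I (n + 1) W)) :
    (transitionMap I n V).hom ((res I (n + 1) h).hom s) =
      (res I n h).hom ((transitionMap I n W).hom s) :=
  congr($(res_transition I n h).hom s)

/-- Restriction of sections of `lim_n 𝒪_X / I ^ (n + 1)`. -/
noncomputable def sectionsRes {V W : Opens (space I)} (h : V ≤ W) :
    sections I W →+* sections I V where
  toFun s := ⟨fun n ↦ (res I n h).hom (s.1 n), fun n ↦ by
    rw [res_transition_apply, s.2 n]⟩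
  map_one' := by ext n; simp
  map_mul' a b := by ext n; simp
  map_zero' := by ext n; simp
  map_add' a b := by ext n; simp

/-- The presheaf `lim_n 𝒪_X / I ^ (n + 1)` on `Y`. -/
noncomputable def presheaf : (space I).Presheaf CommRingCat.{u} where
  obj V := CommRingCat.of (sections I V.unop)
  map f := CommRingCat.ofHom (sectionsRes I f.unop.le)
  map_id V := by
    refine CommRingCat.hom_ext (RingHom.ext fun s ↦ Subtype.ext (funext fun n ↦ ?_))
    change (res I n _).hom (s.1 n) = s.1 n
    have : res I n (le_refl V.unop) = 𝟙 _ := (nbhd I n).presheaf.map_id _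
    exact congr($(this).hom (s.1 n))
  map_comp {U V W} f g := by
    refine CommRingCat.hom_ext (RingHom.ext fun s ↦ Subtype.ext (funext fun n ↦ ?_))
    have : res I n (g.unop.le.trans f.unop.le) = res I n f.unop.le ≫ res I n g.unop.le := by
      rw [← Functor.map_comp]; rfl
    exact congr($(this).hom (s.1 n))

lemma pull_iSup (n : ℕ) {ι : Type*} (V : ι → Opens (space I)) :
    pull I n (iSup V) ≤ ⨆ i, pull I n (V i) := by
  intro y hy
  have hy' : toSpace I n y ∈ iSup V := hy
  obtain ⟨i, hi⟩ := Opens.mem_iSup.mp hy'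
  exact Opens.mem_iSup.mpr ⟨i, hi⟩

lemma presheaf_isSheaf : (presheaf I).IsSheaf := by
  rw [TopCat.Presheaf.isSheaf_iff_isSheafUniqueGluing]
  intro ι V sf hsf
  have key (n : ℕ) : ∃! t : Γ(nbhd I n, pull I n (iSup V)),
      ∀ i, (res I n (le_iSup V i)).hom t = (sf i).1 n := by
    refine (nbhd I n).sheaf.existsUnique_gluing' (fun i ↦ pull I n (V i)) (pull I n (iSup V))
      (fun i ↦ (Opens.map (toSpace I n)).map (homOfLE (le_iSup V i))) (pull_iSup I n V)
      (fun i ↦ (sf i).1 n) ?_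
    intro i j
    exact congr(($(hsf i j)).1 n)
  choose t ht ht' using key
  have hsep (n : ℕ) (a b : Γ(nbhd I n, pull I n (iSup V)))
      (hab : ∀ i, (res I n (le_iSup V i)).hom a = (res I n (le_iSup V i)).hom b) : a = b :=
    (nbhd I n).sheaf.eq_of_locally_eq' (fun i ↦ pull I n (V i)) (pull I n (iSup V))
      (fun i ↦ (Opens.map (toSpace I n)).map (homOfLE (le_iSup V i))) (pull_iSup I n V) a b hab
  have hcomp : ∀ n, (transitionMap I n (iSup V)).hom (t (n + 1)) = t n := by
    intro n
    refine hsep n _ _ fun i ↦ ?_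
    rw [← res_transition_apply, ht, ht]
    exact (sf i).2 n
  refine ⟨⟨t, hcomp⟩, fun i ↦ Subtype.ext (funext fun n ↦ ht n i), fun s hs ↦ ?_⟩
  refine Subtype.ext (funext fun n ↦ ht' n _ fun i ↦ ?_)
  exact congr(($(hs i)).1 n)

end general

end FormalCompletion

open FormalCompletion in
/-- The formal completion of the scheme `X` along the closed subset `Y = V(I)`: the space `Y`
with the sheaf of rings `lim_n 𝒪_X / I ^ n`. -/
noncomputable def formalCompletion {X : Scheme.{u}} (I : X.IdealSheafData) :
    SheafedSpace CommRingCat.{u} where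
  carrier := space I
  presheaf := presheaf I
  IsSheaf := presheaf_isSheaf I

namespace FormalCompletion

variable {X : Scheme.{u}} (I : X.IdealSheafData)

/-- The inclusion of `Y` into `X`. -/
noncomputable def inclusion : space I ⟶ (X.carrier : TopCat.{u}) :=
  TopCat.ofHom ⟨Subtype.val, continuous_subtype_val⟩

lemma pull_inclusion_le (n : ℕ) (U : X.Opens) :
    pull I n ((Opens.map (inclusion I)).obj U) ≤ nbhdι I n ⁻¹ᵁ U :=
  le_refl (nbhdι I n ⁻¹ᵁ U)

/-- Restriction of sections of `𝒪_X` to the `n`-th infinitesimal neighbourhood. -/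
noncomputable def toNbhd (n : ℕ) (U : X.Opens) :
    Γ(X, U) ⟶ Γ(nbhd I n, pull I n ((Opens.map (inclusion I)).obj U)) :=
  (nbhdι I n).appLE U _ (pull_inclusion_le I n U)

lemma toNbhd_transition (n : ℕ) (U : X.Opens) :
    toNbhd I (n + 1) U ≫ transitionMap I n _ = toNbhd I n U := by
  have h := Scheme.Hom.appLE_comp_appLE (transition I n) (nbhdι I (n + 1)) U
    (pull I (n + 1) ((Opens.map (inclusion I)).obj U))
    (pull I n ((Opens.map (inclusion I)).obj U)) (pull_inclusion_le I (n + 1) U)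
    (pull_le I n _)
  simp only [transition_ι] at h
  exact h

/-- The family of restrictions of a section of `𝒪_X` to all infinitesimal neighbourhoods. -/
noncomputable def toSections (U : X.Opens) :
    Γ(X, U) →+* sections I ((Opens.map (inclusion I)).obj U) :=
  RingHom.codRestrict (RingHom.pi fun n ↦ (toNbhd I n U).hom) (sections I _) fun s n ↦
    congr($(toNbhd_transition I n U).hom s)

end FormalCompletion

open FormalCompletion in
/-- The canonical morphism of ringed spaces from the formal completion to `X`. -/
noncomputable def formalCompletionι {X : Scheme.{u}} (I : X.IdealSheafData) :
    formalCompletion I ⟶ X.toSheafedSpace :=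
  InducedCategory.homMk
    { base := inclusion I
      c :=
        { app := fun U ↦ CommRingCat.ofHom (toSections I U.unop)
          naturality := fun U V f ↦ by
            refine CommRingCat.hom_ext (RingHom.ext fun s ↦ Subtype.ext (funext fun n ↦ ?_))
            have h : X.presheaf.map f ≫ toNbhd I n V.unop = toNbhd I n U.unop ≫
                res I n ((Opens.map (inclusion I)).map f.unop).le := by
              rw [toNbhd, toNbhd, Scheme.Hom.map_appLE, Scheme.Hom.appLE_map]
            exact congr($(h).hom s) } }

/-- The closed subset `Y = V(I)` is `G₂` in the scheme `X`: the canonical map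
`H⁰(X, 𝒪_X) → H⁰(X̂, 𝒪_X̂)` to the ring of global sections of the formal completion `X̂` of `X`
along `Y` is an isomorphism. (On a noetherian scheme this depends only on `Y`.) -/
def IsG2 {X : Scheme.{u}} (I : X.IdealSheafData) : Prop :=
  IsIso ((formalCompletionι I).hom.c.app (op ⊤))

section local_ring

variable (R : Type u) [CommRing R]

/-- The spectrum of a local ring with its closed point removed, as an open subset. -/
noncomputable def puncturedSpecOpen [IsLocalRing R] : (Spec (CommRingCat.of R)).Opens :=
  ⟨{IsLocalRing.closedPoint R}ᶜ, (IsLocalRing.isClosed_singleton_closedPoint R).isOpen_compl⟩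

/-- The punctured spectrum `X = Spec R \ {𝔪}` of a local ring, as a scheme. -/
noncomputable abbrev puncturedSpec [IsLocalRing R] : Scheme.{u} := (puncturedSpecOpen R).toScheme

/-- The canonical ring homomorphism `R → H⁰(X, 𝒪_X)` for `X` the punctured spectrum. -/
noncomputable def toPuncturedSections [IsLocalRing R] :
    CommRingCat.of R ⟶ Γ(puncturedSpec R, ⊤) :=
  (Scheme.ΓSpecIso (CommRingCat.of R)).inv ≫ (puncturedSpecOpen R).ι.appTop

/-- The ideal sheaf on `Spec R` associated with an ideal of `R`. -/
noncomputable def idealSheaf {R : Type u} [CommRing R] (a : Ideal R) :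
    (Spec (CommRingCat.of R)).IdealSheafData :=
  Scheme.IdealSheafData.ofIdealTop (a.map (Scheme.ΓSpecIso (CommRingCat.of R)).inv.hom)

/-- The restriction to the punctured spectrum of the ideal sheaf associated with an ideal `𝔞`;
its support is `Y = V(𝔞) \ {𝔪}`. -/
noncomputable def puncturedIdealSheaf {R : Type u} [CommRing R] [IsLocalRing R] (a : Ideal R) :
    (puncturedSpec R).IdealSheafData :=
  (idealSheaf a).comap (puncturedSpecOpen R).ι

lemma mem_support_puncturedIdealSheaf {R : Type u} [CommRing R] [IsLocalRing R] (a : Ideal R)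
    (p : puncturedSpec R) :
    p ∈ (puncturedIdealSheaf a).support ↔ a ≤ ((puncturedSpecOpen R).ι p).asIdeal := by
  have h1 : p ∈ (puncturedIdealSheaf a).support ↔
      (puncturedSpecOpen R).ι p ∈ ((idealSheaf a).support : Set (Spec (CommRingCat.of R))) := by
    rw [puncturedIdealSheaf, Scheme.IdealSheafData.support_comap]
    rfl
  rw [h1, idealSheaf, Scheme.IdealSheafData.coe_support_ofIdealTop, Ideal.map,
    Scheme.zeroLocus_span, Scheme.mem_zeroLocus_iff]
  simp only [Set.mem_image, forall_exists_index, and_imp, forall_apply_eq_imp_iff₂]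
  refine forall₂_congr fun r _ ↦ ?_
  rw [basicOpen_eq_of_affine]
  exact not_not

end local_ring

/-!
That `R = H⁰(X, 𝒪_X)` is a depth argument: a section on `X` is multiplied into `R` by a power of
`𝔪`, and a normal noetherian domain in which `𝔪` has height at least two contains every such
element of its fraction field.

Since `𝔞` has height `d - 1`, every prime other than `𝔪` containing `𝔞` is minimal over `𝔞`, so
there are finitely many of them and prime avoidance provides `x ∈ 𝔪` outside all of them. This `x`
vanishes nowhere on `Y`, so it is invertible on each infinitesimal neighbourhood and hence in
`H⁰(X̂, 𝒪)`. If `Y` were `G₂` in `X`, then `x` would already be invertible on `X`, so `𝔪` would be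
the only prime containing `x`, contradicting Krull's principal ideal theorem. If `H⁰(X̂, 𝒪)` were
finite over `R`, then, being nonzero and integral over a local ring, it could not turn the
nonunit `x` into a unit.
-/

section

open IsLocalRing

section CommutativeAlgebra

lemma ne_bot_of_height_pos {R : Type*} [CommRing R] [Nontrivial R] {I : Ideal R}
    (hI : 0 < I.height) : I ≠ ⊥ := by
  rintro rfl
  exact hI.ne' Ideal.height_bot

lemma dvd_of_span_singleton_mul_le_span_singleton_mul {R : Type*} [CommRing R] [IsDomain R]
    [IsIntegrallyClosed R] {I : Ideal R} (hI : I.FG) (hI0 : I ≠ ⊥) {b c : R}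
    (h : Ideal.span {b} * I ≤ Ideal.span {c} * I) : c ∣ b := by
  rw [Ideal.span_singleton_mul_le_span_singleton_mul] at h
  obtain ⟨y, hyI, hy⟩ := Submodule.exists_mem_ne_zero_of_ne_bot hI0
  rcases eq_or_ne c 0 with rfl | hc
  · obtain ⟨z, -, hz⟩ := h y hyI
    simp_all
  let K := FractionRing R
  have hcK : algebraMap R K c ≠ 0 := by simpa using hc
  let N : Submodule R K := Submodule.map (Algebra.linearMap R K) I
  have hN : N ≠ ⊥ := (Submodule.ne_bot_iff _).mpr
    ⟨algebraMap R K y, Submodule.mem_map_of_mem hyI, by simpa using hy⟩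
  have hx : IsIntegral R (algebraMap R K b / algebraMap R K c) := by
    refine isIntegral_of_smul_mem_submodule N hN (Submodule.FG.map _ hI) _ ?_
    rintro _ ⟨z, hz, rfl⟩
    obtain ⟨w, hw, hbw⟩ := h z hz
    refine ⟨w, hw, ?_⟩
    rw [Algebra.linearMap_apply, Algebra.linearMap_apply, smul_eq_mul, div_mul_eq_mul_div,
      eq_div_iff hcK, ← map_mul, ← map_mul, hbw, mul_comm]
  obtain ⟨r, hr⟩ := IsIntegrallyClosed.isIntegral_iff.mp hx
  refine ⟨r, IsFractionRing.injective R K ?_⟩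
  rw [map_mul, hr, mul_div_cancel₀ _ hcK]

lemma isPrincipal_maximalIdeal_of_span_singleton_mul_le {R : Type*} [CommRing R] [IsDomain R]
    [IsLocalRing R] {b c : R} (hle : Ideal.span {b} * maximalIdeal R ≤ Ideal.span {c})
    (hnle : ¬ Ideal.span {b} * maximalIdeal R ≤ Ideal.span {c} * maximalIdeal R) :
    (maximalIdeal R).IsPrincipal := by
  have hc : c ≠ 0 := by
    rintro rfl
    simp_all
  rw [Ideal.span_singleton_mul_le_iff] at hle hnle
  push Not at hnle
  obtain ⟨y, hy, hby⟩ := hnle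
  obtain ⟨u, hu⟩ := Ideal.mem_span_singleton.mp (hle y hy)
  have hu_unit : IsUnit u := by
    by_contra hu_mem
    exact hby (hu ▸ Ideal.mul_mem_mul (Ideal.mem_span_singleton_self c) hu_mem)
  refine ⟨y, le_antisymm (fun z hz ↦ ?_) ((Ideal.span_singleton_le_iff_mem _).mpr hy)⟩
  obtain ⟨w, hw⟩ := Ideal.mem_span_singleton.mp (hle z hz)
  have hzu : z * u = y * w := mul_left_cancel₀ hc (by linear_combination y * hw - z * hu)
  exact Ideal.mem_span_singleton.mpr (hu_unit.dvd_mul_right.mp ⟨w, hzu⟩)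

variable {R : Type*} [CommRing R] [IsLocalRing R]

lemma exists_isPrime_le_ne_maximalIdeal {a : Ideal R} (ha : a.height < (maximalIdeal R).height) :
    ∃ p : Ideal R, p.IsPrime ∧ a ≤ p ∧ p ≠ maximalIdeal R := by
  lift a.height to ℕ using ha.ne_top with n hn
  obtain ⟨p, hp, hap, hpn⟩ := Ideal.exists_isPrime_height_eq hn.symm
  exact ⟨p, hp, hap, fun hpm ↦ ha.ne (hpm ▸ hpn.symm)⟩

lemma isLocalHom_of_isIntegral {S : Type*} [CommRing S] [Nontrivial S] {φ : R →+* S}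
    (hφ : φ.IsIntegral) : IsLocalHom φ := by
  have hrange : IsLocalHom φ.rangeRestrict := .of_surjective _ φ.rangeRestrict_surjective
  have hsubtype : IsLocalHom φ.range.subtype :=
    RingHom.IsIntegral.isLocalHom (RingHom.IsIntegral.tower_top φ.rangeRestrict _ hφ)
      Subtype.val_injective
  exact RingHom.isLocalHom_comp φ.range.subtype φ.rangeRestrict

variable [IsNoetherianRing R]

section IsIntegrallyClosed

variable [IsDomain R] [IsIntegrallyClosed R]

/- `b / c` maps `𝔪` into `R`. If the image lies in `𝔪`, then `b / c` is integral over `R`;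
otherwise `𝔪` is principal, which Krull's principal ideal theorem excludes. -/
lemma dvd_of_span_singleton_mul_maximalIdeal_le (hR : 1 < (maximalIdeal R).height) {b c : R}
    (h : Ideal.span {b} * maximalIdeal R ≤ Ideal.span {c}) : c ∣ b := by
  have hm0 : maximalIdeal R ≠ ⊥ := ne_bot_of_height_pos (zero_lt_one.trans hR)
  refine dvd_of_span_singleton_mul_le_span_singleton_mul (IsNoetherian.noetherian _) hm0 ?_
  by_contra hle
  have hprincipal := isPrincipal_maximalIdeal_of_span_singleton_mul_le h hle
  exact hR.not_ge (Ideal.height_le_one_of_isPrincipal_of_mem_minimalPrimes (maximalIdeal R) _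
    (by simp [Ideal.minimalPrimes_eq_subsingleton_self]))

lemma dvd_of_span_singleton_mul_maximalIdeal_pow_le (hR : 1 < (maximalIdeal R).height) {b c : R}
    (n : ℕ) (h : Ideal.span {b} * maximalIdeal R ^ n ≤ Ideal.span {c}) : c ∣ b := by
  induction n with
  | zero => simpa [← Ideal.mem_span_singleton] using h
  | succ n ih =>
    refine ih (Ideal.span_singleton_mul_le_iff.mpr fun y hy ↦ Ideal.mem_span_singleton.mpr ?_)
    refine dvd_of_span_singleton_mul_maximalIdeal_le hR
      (Ideal.span_singleton_mul_le_iff.mpr fun z hz ↦ ?_)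
    rw [mul_assoc]
    exact Ideal.span_singleton_mul_le_iff.mp h _ (pow_succ (maximalIdeal R) n ▸
      Ideal.mul_mem_mul hy hz)

lemma mem_range_of_forall_exists_map_pow_mul_mem_range {S : Type*} [CommRing S] [IsDomain S]
    (hR : 1 < (maximalIdeal R).height) {φ : R →+* S} (hφ : Function.Injective φ) {s : S}
    (h : ∀ x ∈ maximalIdeal R, ∃ n : ℕ, φ (x ^ n) * s ∈ φ.range) : s ∈ φ.range := by
  algebraize [φ]
  let J : Ideal R := (LinearMap.range (Algebra.linearMap R S)).colon {s}
  have mem_J {x : R} : x ∈ J ↔ φ x * s ∈ φ.range := Submodule.mem_colon_singleton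
  obtain ⟨n, hn⟩ := Ideal.exists_pow_le_of_le_radical_of_fg
    (fun x hx ↦ (h x hx).imp fun _ ↦ mem_J.mpr : maximalIdeal R ≤ J.radical)
    (IsNoetherian.noetherian _)
  have hm0 : maximalIdeal R ≠ ⊥ := ne_bot_of_height_pos (zero_lt_one.trans hR)
  obtain ⟨c, hcm, hc⟩ := Submodule.exists_mem_ne_zero_of_ne_bot (pow_ne_zero n hm0)
  obtain ⟨b, hb⟩ := mem_J.mp (hn hcm)
  obtain ⟨r, rfl⟩ : c ∣ b := by
    refine dvd_of_span_singleton_mul_maximalIdeal_pow_le hR n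
      (Ideal.span_singleton_mul_le_iff.mpr fun y hy ↦ Ideal.mem_span_singleton.mpr ?_)
    obtain ⟨r, hr⟩ := mem_J.mp (hn hy)
    refine ⟨r, hφ ?_⟩
    rw [map_mul, map_mul, hb, hr]
    ring
  refine ⟨r, mul_left_cancel₀ ((map_ne_zero_iff φ hφ).mpr hc) ?_⟩
  rw [← map_mul, hb]

end IsIntegrallyClosed

lemma mem_minimalPrimes_of_le_of_ne_maximalIdeal {a p : Ideal R} [p.IsPrime]
    (ha : (maximalIdeal R).height ≤ a.height + 1) (hap : a ≤ p) (hp : p ≠ maximalIdeal R) :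
    p ∈ a.minimalPrimes := by
  refine Ideal.mem_minimalPrimes_of_height_le hap ?_
  have hpm : p < maximalIdeal R := (le_maximalIdeal (Ideal.IsPrime.ne_top ‹_›)).lt_of_ne hp
  exact (ENat.add_le_add_iff_right ENat.one_ne_top).mp
    ((Ideal.height_add_one_le_of_lt_of_isPrime hpm).trans ha)

lemma exists_mem_maximalIdeal_forall_notMem {a : Ideal R}
    (ha : (maximalIdeal R).height ≤ a.height + 1) :
    ∃ x ∈ maximalIdeal R, ∀ p : Ideal R, p.IsPrime → a ≤ p → p ≠ maximalIdeal R → x ∉ p := by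
  let P : Set (Ideal R) := {p | p.IsPrime ∧ a ≤ p ∧ p ≠ maximalIdeal R}
  have hP : P.Finite := a.finite_minimalPrimes_of_isNoetherianRing.subset
    fun p ⟨_, hap, hpm⟩ ↦ mem_minimalPrimes_of_le_of_ne_maximalIdeal ha hap hpm
  by_contra! hcover
  have hsubset : (maximalIdeal R : Set R) ⊆ ⋃ p ∈ P, p := fun x hx ↦ by
    obtain ⟨p, hp, hap, hpm, hxp⟩ := hcover x hx
    exact Set.mem_biUnion (⟨hp, hap, hpm⟩ : p ∈ P) hxp
  obtain ⟨p, ⟨hp, -, hpm⟩, hmp⟩ :=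
    (Ideal.subset_union_prime_finite hP (f := id) ⊤ ⊤ fun p hp _ _ ↦ hp.1).mp hsubset
  exact hpm (le_antisymm (le_maximalIdeal hp.ne_top) hmp)

end CommutativeAlgebra

namespace FormalCompletion

variable {X : Scheme.{u}} {I : X.IdealSheafData}

lemma isUnit_of_forall_isUnit {V : Opens (space I)} {s : sections I V}
    (h : ∀ n, IsUnit (s.1 n)) : IsUnit s := by
  choose t ht using fun n ↦ (h n).exists_right_inv
  have ht_mem : t ∈ sections I V := fun n ↦ (h n).mul_left_cancel <| by
    rw [ht n, ← s.2 n, ← map_mul, ht (n + 1), map_one]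
  exact IsUnit.of_mul_eq_one ⟨t, ht_mem⟩ (Subtype.ext (funext ht))

lemma isUnit_toSections {U : X.Opens} {f : Γ(X, U)}
    (hf : ∀ y ∈ U, y ∈ I.support → y ∈ X.basicOpen f) : IsUnit (toSections I U f) := by
  refine isUnit_of_forall_isUnit fun n ↦ RingedSpace.isUnit_of_isUnit_germ _ _ _ fun y hy ↦ ?_
  refine ((nbhd I n).mem_basicOpen _ y hy).mp ?_
  change y ∈ (nbhd I n).basicOpen ((nbhdι I n).appLE U _ (pull_inclusion_le I n U) f)
  rw [Scheme.basicOpen_appLE]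
  exact ⟨hy, hf _ (pull_inclusion_le I n U hy) (nbhdι_mem I n y)⟩

lemma nontrivial_sections {V : Opens (space I)} (hV : (V : Set (space I)).Nonempty) :
    Nontrivial (sections I V) := by
  obtain ⟨⟨y, hy⟩, hyV⟩ := hV
  obtain ⟨z, rfl⟩ : y ∈ Set.range (nbhdι I 0) := by
    rw [Scheme.IdealSheafData.range_subschemeι]
    simpa using hy
  have : Nonempty (pull I 0 V) := ⟨⟨z, hyV⟩⟩
  have : Nontrivial Γ(nbhd I 0, pull I 0 V) := inferInstance
  exact ((Pi.evalRingHom _ 0).comp (sections I V).subtype).domain_nontrivial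

end FormalCompletion

lemma exists_restrict_eq_pow_mul {X : Scheme.{u}} [CompactSpace X] [QuasiSeparatedSpace X]
    {U : X.Opens} (hU : IsCompact (U : Set X)) {f : Γ(X, ⊤)} (hf : X.basicOpen f ≤ U)
    (s : Γ(X, U)) : ∃ (n : ℕ) (t : Γ(X, ⊤)), t |_ U = (f |_ U) ^ n * s := by
  obtain ⟨n, y, hy⟩ := exists_eq_pow_mul_of_isCompact_of_isQuasiSeparated X ⊤
    isCompact_univ isQuasiSeparated_univ f (s |_ X.basicOpen f)
  have hD : X.basicOpen (f |_ U) = X.basicOpen f :=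
    (X.basicOpen_res f _).trans (inf_eq_right.mpr hf)
  have hres : (y |_ U - (f |_ U) ^ n * s) |_ X.basicOpen (f |_ U) = 0 := by
    suffices ∀ (D : X.Opens) (hDU : D ≤ U), D = X.basicOpen f →
        (y |_ U - (f |_ U) ^ n * s) |_ D = 0 from this _ (X.basicOpen_le _) hD
    rintro _ hfU rfl
    simp only [TopCat.Presheaf.restrictOpenCommRingCat_apply, map_sub, map_mul, map_pow,
      ← CommRingCat.comp_apply, ← Functor.map_comp, sub_eq_zero] at hy ⊢
    exact hy
  obtain ⟨m, hm⟩ := exists_pow_mul_eq_zero_of_res_basicOpen_eq_zero_of_isCompact X hU _ _ hres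
  refine ⟨m + n, f ^ m * y, ?_⟩
  rw [mul_sub, sub_eq_zero, ← mul_assoc, ← pow_add] at hm
  rw [← hm]
  simp only [TopCat.Presheaf.restrictOpenCommRingCat_apply, map_mul, map_pow]

section puncturedSpec

variable {R : Type u} [CommRing R] [IsLocalRing R]

lemma mem_basicOpen_toPuncturedSections {x : R} {p : puncturedSpec R} :
    p ∈ (puncturedSpec R).basicOpen ((toPuncturedSections R).hom x) ↔
      x ∉ ((puncturedSpecOpen R).ι p).asIdeal := by
  change p ∈ (puncturedSpec R).basicOpen ((puncturedSpecOpen R).ι.appTop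
    ((Scheme.ΓSpecIso (CommRingCat.of R)).inv x)) ↔ _
  rw [← Scheme.preimage_basicOpen_top, basicOpen_eq_of_affine]
  rfl

lemma height_maximalIdeal_le_one_of_isUnit_toPuncturedSections [IsNoetherianRing R] {x : R}
    (hx : x ∈ maximalIdeal R) (hunit : IsUnit ((toPuncturedSections R).hom x)) :
    (maximalIdeal R).height ≤ 1 := by
  have eq_maximalIdeal {p : Ideal R} (hp : p.IsPrime) (hxp : x ∈ p) : p = maximalIdeal R := by
    by_contra hpm
    let y : puncturedSpec R := ⟨⟨p, hp⟩, fun h ↦ hpm (congrArg PrimeSpectrum.asIdeal h)⟩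
    have hy : y ∈ (puncturedSpec R).basicOpen ((toPuncturedSections R).hom x) := by
      rw [Scheme.basicOpen_of_isUnit _ hunit]
      trivial
    exact mem_basicOpen_toPuncturedSections.mp hy hxp
  obtain ⟨p, hp, -⟩ := Ideal.exists_minimalPrimes_le
    ((Ideal.span_singleton_le_iff_mem (maximalIdeal R)).mpr hx)
  rw [← eq_maximalIdeal hp.isPrime (hp.le (Ideal.mem_span_singleton_self x))]
  exact Ideal.height_le_one_of_isPrincipal_of_mem_minimalPrimes _ p hp

section IsDomain

variable [IsDomain R]

lemma nonempty_puncturedSpec (hR : maximalIdeal R ≠ ⊥) : Nonempty (puncturedSpec R) :=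
  ⟨⟨⟨⊥, Ideal.isPrime_bot⟩, fun h ↦ hR (congrArg PrimeSpectrum.asIdeal h).symm⟩⟩

lemma toPuncturedSections_injective (hR : maximalIdeal R ≠ ⊥) :
    Function.Injective (toPuncturedSections R).hom := by
  have : IsDomain (CommRingCat.of R) := inferInstanceAs (IsDomain R)
  obtain ⟨y⟩ := nonempty_puncturedSpec hR
  have : Nonempty ((puncturedSpecOpen R).ι ''ᵁ ⊤ : (Spec (CommRingCat.of R)).Opens) :=
    ⟨⟨_, y, trivial, rfl⟩⟩
  exact (map_injective_of_isIntegral (Spec (CommRingCat.of R))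
    (homOfLE (le_top : (puncturedSpecOpen R).ι ''ᵁ ⊤ ≤ ⊤))).comp
    (ConcreteCategory.bijective_of_isIso (Scheme.ΓSpecIso (CommRingCat.of R)).inv).injective

end IsDomain

variable [IsNoetherianRing R]

lemma exists_toPuncturedSections_pow_mul_mem_range {x : R} (hx : x ∈ maximalIdeal R)
    (s : Γ(puncturedSpec R, ⊤)) :
    ∃ n : ℕ, (toPuncturedSections R).hom (x ^ n) * s ∈ (toPuncturedSections R).hom.range := by
  let A := CommRingCat.of R
  let U : (Spec A).Opens := (puncturedSpecOpen R).ι ''ᵁ ⊤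
  have : IsNoetherianRing A := inferInstanceAs (IsNoetherianRing R)
  have hU : IsCompact (U : Set (Spec A)) := NoetherianSpace.isCompact _
  have hxU : (Spec A).basicOpen ((Scheme.ΓSpecIso A).inv x) ≤ U := by
    refine le_of_le_of_eq ?_ (puncturedSpecOpen R).ι_image_top.symm
    rw [basicOpen_eq_of_affine]
    rintro p hp rfl
    exact hp hx
  obtain ⟨n, t, ht⟩ := exists_restrict_eq_pow_mul hU hxU s
  obtain ⟨r, rfl⟩ := (ConcreteCategory.bijective_of_isIso (Scheme.ΓSpecIso A).inv).surjective t
  exact ⟨n, r, by rw [map_pow]; exact ht⟩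

lemma toPuncturedSections_bijective [IsDomain R] [IsIntegrallyClosed R]
    (hR : 1 < (maximalIdeal R).height) : Function.Bijective (toPuncturedSections R).hom := by
  have hm0 : maximalIdeal R ≠ ⊥ := ne_bot_of_height_pos (zero_lt_one.trans hR)
  have hinj := toPuncturedSections_injective hm0
  have := nonempty_puncturedSpec hm0
  exact ⟨hinj, fun s ↦ mem_range_of_forall_exists_map_pow_mul_mem_range hR hinj fun x hx ↦
    exists_toPuncturedSections_pow_mul_mem_range hx s⟩

lemma exists_mem_maximalIdeal_isUnit_formalCompletionι {a : Ideal R}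
    (ha : (maximalIdeal R).height ≤ a.height + 1) :
    ∃ x ∈ maximalIdeal R, IsUnit (((formalCompletionι (puncturedIdealSheaf a)).hom.c.app
      (op ⊤)).hom ((toPuncturedSections R).hom x)) := by
  obtain ⟨x, hxm, hx⟩ := exists_mem_maximalIdeal_forall_notMem ha
  refine ⟨x, hxm, FormalCompletion.isUnit_toSections fun y _ hy ↦ ?_⟩
  exact mem_basicOpen_toPuncturedSections.mpr <| hx _ ((puncturedSpecOpen R).ι y).isPrime
    ((mem_support_puncturedIdealSheaf a y).mp hy) fun h ↦ y.2 (PrimeSpectrum.ext h)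

theorem not_isG2_puncturedIdealSheaf {a : Ideal R} (hR : 1 < (maximalIdeal R).height)
    (ha : (maximalIdeal R).height ≤ a.height + 1) : ¬ IsG2 (puncturedIdealSheaf a) := by
  intro hG2
  have : IsIso ((formalCompletionι (puncturedIdealSheaf a)).hom.c.app (op ⊤)) := hG2
  obtain ⟨x, hxm, hx⟩ := exists_mem_maximalIdeal_isUnit_formalCompletionι ha
  exact hR.not_ge (height_maximalIdeal_le_one_of_isUnit_toPuncturedSections hxm
    (isUnit_of_map_unit _ _ hx))

theorem not_finite_formalCompletion_sections {a : Ideal R}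
    (ha : a.height + 1 = (maximalIdeal R).height) :
    ¬ (toPuncturedSections R ≫
        (formalCompletionι (puncturedIdealSheaf a)).hom.c.app (op ⊤)).hom.Finite := by
  intro hfinite
  have ha_lt : a.height < (maximalIdeal R).height := by
    rw [← ha, ENat.lt_add_one_iff]
    intro ha_top
    exact Ideal.height_ne_top_of_isPrime (I := maximalIdeal R) (by rw [← ha, ha_top, top_add])
  obtain ⟨p, hp, hap, hpm⟩ := exists_isPrime_le_ne_maximalIdeal ha_lt
  let y : puncturedSpec R := ⟨⟨p, hp⟩, fun h ↦ hpm (congrArg PrimeSpectrum.asIdeal h)⟩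
  have hy : y ∈ (puncturedIdealSheaf a).support :=
    (mem_support_puncturedIdealSheaf a y).mpr hap
  have := FormalCompletion.nontrivial_sections (I := puncturedIdealSheaf a)
    (V := (Opens.map (FormalCompletion.inclusion _)).obj ⊤) ⟨⟨y, hy⟩, trivial⟩
  have hlocal := isLocalHom_of_isIntegral (S := FormalCompletion.sections (puncturedIdealSheaf a)
    ((Opens.map (FormalCompletion.inclusion _)).obj ⊤)) hfinite.to_isIntegral
  obtain ⟨x, hxm, hx⟩ := exists_mem_maximalIdeal_isUnit_formalCompletionι ha.ge
  exact hxm (hlocal.map_nonunit x hx)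

end puncturedSpec

end

theorem corollary4p2_general (R : Type u) [CommRing R] [IsDomain R] [IsLocalRing R]
    [IsNoetherianRing R] [IsIntegrallyClosed R] (d : ℕ) (hd : 2 ≤ d) (hdim : ringKrullDim R = d)
    (a : Ideal R) (ha : a.height = ((d - 1 : ℕ) : ℕ∞)) :
    ¬ IsG2 (puncturedIdealSheaf a) ∧
    Function.Bijective (toPuncturedSections R).hom ∧
    ¬ (toPuncturedSections R ≫
        (formalCompletionι (puncturedIdealSheaf a)).hom.c.app (op ⊤)).hom.Finite := by
  have hm : (IsLocalRing.maximalIdeal R).height = d := by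
    exact_mod_cast IsLocalRing.maximalIdeal_height_eq_ringKrullDim.trans hdim
  have hR : 1 < (IsLocalRing.maximalIdeal R).height := by
    rw [hm]
    exact_mod_cast hd
  have ha' : a.height + 1 = (IsLocalRing.maximalIdeal R).height := by
    rw [ha, hm]
    exact_mod_cast Nat.sub_add_cancel (one_le_two.trans hd)
  exact ⟨not_isG2_puncturedIdealSheaf hR ha'.ge, toPuncturedSections_bijective hR,
    not_finite_formalCompletion_sections ha'⟩

theorem corollary4p2 (R : Type u) [CommRing R] [IsDomain R] [IsLocalRing R] [IsNoetherianRing R]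
    [IsAdicComplete (IsLocalRing.maximalIdeal R) R] [IsIntegrallyClosed R]
    (d : ℕ) (hd : 2 ≤ d) (hdim : ringKrullDim R = d)
    (a : Ideal R) (ha : a.height = ((d - 1 : ℕ) : ℕ∞)) :
    ¬ IsG2 (puncturedIdealSheaf a) ∧
    Function.Bijective (toPuncturedSections R).hom ∧
    ¬ (toPuncturedSections R ≫
        (formalCompletionι (puncturedIdealSheaf a)).hom.c.app (op ⊤)).hom.Finite :=
  corollary4p2_general R d hd hdim a ha
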